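/- Let $q$ be a positive real number, $q\neq1$, let $N\ge3$ be an integer, and let $\Bbbk\in\{\mathbb R,\mathbb C\}$. Indices run from $1$ to $N$, pairs of equal upper and lower indices are summed over, $i'=N+1-i$, and a condition in parentheses stands for $1$ if it holds and $0$ otherwise. Let $\varrho_i=\frac N2-i$, $0$, $\frac N2-i+1$ for $i<\frac{N+1}2$, $i=\frac{N+1}2$, $i>\frac{N+1}2$, respectively, and put $$C^{ij}=C_{ij}=q^{-\varrho_i}(i=j'),\qquad K^{kl}_{ij}=C^{ij}C_{kl},$$ $$\hat R^{kl}_{ij}=q^{(k=l)-(k=l')}(i=l)(j=k)+(q-q^{-1})(i<l)\bigl((i=k)(j=l)-K^{kl}_{ij}\bigr),$$ $$\hat R^{-1}=\hat R-(q-q^{-1})I+(q-q^{-1})K,\qquad I^{kl}_{ij}=(i=k)(j=l).$$ Let $X$ be the coordinate algebra of the quantum Euclidean sphere $S_q^{N-1}$, i.e. the unital $\Bbbk$-algebra with generators $x_1,\dots,x_N$ and relations $$(\hat R^{-1})^{kl}_{ij}x_kx_l=q^{-1}x_ix_j+\frac{q^{N-1}-q^{N-3}}{1+q^{N-2}}K^{kl}_{ij}x_kx_l,\qquad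 C^{kl}x_kx_l=1.$$ A first order differential calculus on $X$ is an $X$-bimodule $\Gamma$ with a linear map $\mathrm d:X\to\Gamma$ such that $\mathrm d(xy)=\mathrm dx\cdot y+x\,\mathrm dy$ and such that $\mathrm dX$ generates $\Gamma$ as a left module. Let $\Gamma_+$ and $\Gamma_-$ be the first order differential calculi on $X$ given by the bimodule relations $$\mathrm dx_i\cdot x_j=\pm(\hat R^{-1})^{kl}_{ij}x_k\mathrm dx_l+(\pm q-1)x_i\mathrm dx_j+\frac{q^N-q^{N-2}}{1\mp q^{N-1}}K^{kl}_{ij}x_k\mathrm dx_l+\frac{(1\mp q)(1+q^{N-2})}{1\mp q^{N-1}}C^{kl}x_ix_jx_k\mathrm dx_l\qquad(1\le i,j\le N),\tag{1}$$ with the upper signs for $\Gamma_+$ and the lower signs for $\Gamma_-$; that is, $\Gamma_\pm$ is the bimodule generated by symbols $\mathrm da$ ($a\in X$) subject to linearity of $\mathrm d$, the Leibniz rule, and (1). Then in $\Gamma_+$ (upper signs) and in $\Gamma_-$ (lower signs) one has, for all $i,j$, $$x_i\mathrm dx_j=\pm(\hat R^{-1})^{kl}_{ij}\mathrm dx_k\cdot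 x_l+(\pm q-1)\mathrm dx_i\cdot x_j+\frac{q^N-q^{N-2}}{1\mp q^{N-1}}K^{kl}_{ij}\mathrm dx_k\cdot x_l+\frac{(1\mp q)(1+q^{N-2})}{1\mp q^{N-1}}C^{kl}\mathrm dx_k\cdot x_lx_ix_j.\tag{2}$$ Moreover, for either choice of signs, (1) and (2) are equivalent descriptions of the bimodule structure: an arbitrary first order differential calculus $(\Gamma,\mathrm d)$ on $X$ satisfies (1) for all $i,j$ if and only if it satisfies (2) for all $i,j$. -/

import Mathlib

open scoped TensorProduct RightActions

noncomputable section

namespace QSphere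

/-! ### Structure constants of `O_q(N)`

Indices run through `Fin N`; the index `i = 1, …, N` of the usual notation is `(i : ℕ) + 1`, and
`i' = N + 1 - i` is `Fin.rev i`. -/

/-- `ϱ_i = N/2 - i`, `0`, `N/2 - i + 1` for `i < (N+1)/2`, `i = (N+1)/2`, `i > (N+1)/2`. -/
def rho {N : ℕ} (i : Fin N) : ℝ :=
  if 2 * ((i : ℕ) + 1) < N + 1 then (N : ℝ) / 2 - ((i : ℕ) + 1)
  else if 2 * ((i : ℕ) + 1) = N + 1 then 0
  else (N : ℝ) / 2 - ((i : ℕ) + 1) + 1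

/-- `C^{ij} = C_{ij} = q^{-ϱ_i} (i = j')`. -/
def C (q : ℝ) {N : ℕ} (i j : Fin N) : ℝ :=
  if i = j.rev then q ^ (-rho i) else 0

/-- `K k l i j` is `K^{kl}_{ij} = C^{ij} C_{kl}`. -/
def K (q : ℝ) {N : ℕ} (k l i j : Fin N) : ℝ := C q i j * C q k l

/-- `I k l i j` is the identity `(i = k)(j = l)`. -/
def I {N : ℕ} (k l i j : Fin N) : ℝ := if i = k ∧ j = l then 1 else 0

/-- `R q k l i j` is the entry `R̂^{kl}_{ij}` of the R-matrix of `O_q(N)`. -/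
def R (q : ℝ) {N : ℕ} (k l i j : Fin N) : ℝ :=
  (if i = l ∧ j = k then
      q ^ ((if k = l then (1 : ℝ) else 0) - (if k = l.rev then (1 : ℝ) else 0)) else 0)
    + (q - q⁻¹) * (if i < l then I k l i j - K q k l i j else 0)

/-- `Rinv q k l i j` is the entry of `R̂⁻¹ = R̂ - (q - q⁻¹) I + (q - q⁻¹) K`. -/
def Rinv (q : ℝ) {N : ℕ} (k l i j : Fin N) : ℝ :=
  R q k l i j - (q - q⁻¹) * I k l i j + (q - q⁻¹) * K q k l i j

/-! ### The coordinate algebra of the quantum Euclidean sphere -/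

/-- The defining relations of the quantum Euclidean sphere. -/
inductive SphereRel (𝕜 : Type*) [RCLike 𝕜] (q : ℝ) (N : ℕ) :
    FreeAlgebra 𝕜 (Fin N) → FreeAlgebra 𝕜 (Fin N) → Prop
  | quadratic (i j : Fin N) : SphereRel 𝕜 q N
      (∑ k, ∑ l, ((Rinv q k l i j : ℝ) : 𝕜) • (FreeAlgebra.ι 𝕜 k * FreeAlgebra.ι 𝕜 l))
      (((q⁻¹ : ℝ) : 𝕜) • (FreeAlgebra.ι 𝕜 i * FreeAlgebra.ι 𝕜 j)
        + (((q ^ ((N : ℝ) - 1) - q ^ ((N : ℝ) - 3)) / (1 + q ^ ((N : ℝ) - 2)) : ℝ) : 𝕜) •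
          ∑ k, ∑ l, ((K q k l i j : ℝ) : 𝕜) • (FreeAlgebra.ι 𝕜 k * FreeAlgebra.ι 𝕜 l))
  | sphere : SphereRel 𝕜 q N
      (∑ k, ∑ l, ((C q k l : ℝ) : 𝕜) • (FreeAlgebra.ι 𝕜 k * FreeAlgebra.ι 𝕜 l)) 1

/-- The coordinate algebra `X` of the quantum Euclidean sphere `S_q^{N-1}`. -/
abbrev Sphere (𝕜 : Type*) [RCLike 𝕜] (q : ℝ) (N : ℕ) : Type _ :=
  RingQuot (SphereRel 𝕜 q N)

/-- The generators `x_i`. -/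
def x (𝕜 : Type*) [RCLike 𝕜] (q : ℝ) {N : ℕ} (i : Fin N) : Sphere 𝕜 q N :=
  RingQuot.mkAlgHom 𝕜 (SphereRel 𝕜 q N) (FreeAlgebra.ι 𝕜 i)

/-! ### First order differential calculi

An `X`-bimodule is a left `X`-module which is also a right `X`-module (a module over `Xᵐᵒᵖ`), with
commuting actions inducing the same scalar action of `𝕜`; `ω <• a` is the right action of `a`. -/

/-- `(Γ, d)` is a first order differential calculus: `d` fulfils the Leibniz rule and `d X` spans
`Γ` as a left module. -/
structure IsFODC {𝕜 X Γ : Type*} [CommRing 𝕜] [Ring X] [Algebra 𝕜 X] [AddCommGroup Γ]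
    [Module 𝕜 Γ] [Module X Γ] [Module Xᵐᵒᵖ Γ] [IsScalarTower 𝕜 X Γ] [IsScalarTower 𝕜 Xᵐᵒᵖ Γ]
    [SMulCommClass X Xᵐᵒᵖ Γ] (d : X →ₗ[𝕜] Γ) : Prop where
  leibniz : ∀ a b : X, d (a * b) = (d a) <• b + a • d b
  span_eq_top : Submodule.span X (Set.range d) = ⊤

/-! ### Calculi given by generators and relations -/

section Presented

variable (𝕜 X : Type*) [CommRing 𝕜] [Ring X] [Algebra 𝕜 X]

/-- The free `X`-bimodule on symbols `d a`, `a ∈ X`; bimodules are left modules over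
`X ⊗ Xᵐᵒᵖ`. -/
def PreForms : Type _ := X →₀ (X ⊗[𝕜] Xᵐᵒᵖ)

instance : AddCommGroup (PreForms 𝕜 X) :=
  inferInstanceAs (AddCommGroup (X →₀ (X ⊗[𝕜] Xᵐᵒᵖ)))

instance : Module (X ⊗[𝕜] Xᵐᵒᵖ) (PreForms 𝕜 X) :=
  inferInstanceAs (Module (X ⊗[𝕜] Xᵐᵒᵖ) (X →₀ (X ⊗[𝕜] Xᵐᵒᵖ)))

instance : Module 𝕜 (PreForms 𝕜 X) :=
  inferInstanceAs (Module 𝕜 (X →₀ (X ⊗[𝕜] Xᵐᵒᵖ)))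

instance : IsScalarTower 𝕜 (X ⊗[𝕜] Xᵐᵒᵖ) (PreForms 𝕜 X) :=
  inferInstanceAs (IsScalarTower 𝕜 (X ⊗[𝕜] Xᵐᵒᵖ) (X →₀ (X ⊗[𝕜] Xᵐᵒᵖ)))

variable {X}

/-- The element `a · (d c) · b` of the free bimodule. -/
def pre (a c b : X) : PreForms 𝕜 X := Finsupp.single c (a ⊗ₜ MulOpposite.op b)

theorem smul_pre (s t a b c : X) :
    (s ⊗ₜ[𝕜] MulOpposite.op t) • pre 𝕜 a c b = pre 𝕜 (s * a) c (b * t) := by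
  refine (Finsupp.smul_single (s ⊗ₜ[𝕜] MulOpposite.op t) c (a ⊗ₜ[𝕜] MulOpposite.op b)).trans ?_
  rw [smul_eq_mul, Algebra.TensorProduct.tmul_mul_tmul]
  rfl

theorem PreForms.induct {P : PreForms 𝕜 X → Prop} (h0 : P 0)
    (ha : ∀ f g, P f → P g → P (f + g)) (hp : ∀ a c b, P (pre 𝕜 a c b)) (f : PreForms 𝕜 X) :
    P f := by
  refine Finsupp.induction_linear (motive := P) f h0 ha fun c t => ?_
  refine TensorProduct.induction_on (motive := fun t => P (Finsupp.single c t)) t ?_ ?_ ?_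
  · exact (Finsupp.single_zero (M := X ⊗[𝕜] Xᵐᵒᵖ) c).symm ▸ h0
  · exact fun a b => hp a c b.unop
  · exact fun u v hu hv => (Finsupp.single_add c u v).symm ▸ ha _ _ hu hv

variable (X)

/-- The relations making `d` linear and a derivation. -/
inductive CalcRel : PreForms 𝕜 X → Prop
  | add (a b : X) : CalcRel (pre 𝕜 1 (a + b) 1 - pre 𝕜 1 a 1 - pre 𝕜 1 b 1)
  | smul (c : 𝕜) (a : X) : CalcRel (pre 𝕜 1 (c • a) 1 - c • pre 𝕜 1 a 1)
  | mul (a b : X) : CalcRel (pre 𝕜 1 (a * b) 1 - pre 𝕜 1 a b - pre 𝕜 a b 1)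

variable {X}

/-- The bimodule generated by the symbols `d a` subject to the relations of a differential
calculus and to the additional relations `r = 0`, `r ∈ S`. -/
def Forms (S : Set (PreForms 𝕜 X)) : Type _ :=
  PreForms 𝕜 X ⧸ Submodule.span (X ⊗[𝕜] Xᵐᵒᵖ) ({r | CalcRel 𝕜 X r} ∪ S)

namespace Forms

variable (S : Set (PreForms 𝕜 X))

instance : AddCommGroup (Forms 𝕜 S) := inferInstanceAs (AddCommGroup
    (PreForms 𝕜 X ⧸ Submodule.span (X ⊗[𝕜] Xᵐᵒᵖ) ({r | CalcRel 𝕜 X r} ∪ S)))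

instance : Module (X ⊗[𝕜] Xᵐᵒᵖ) (Forms 𝕜 S) := inferInstanceAs (Module (X ⊗[𝕜] Xᵐᵒᵖ)
    (PreForms 𝕜 X ⧸ Submodule.span (X ⊗[𝕜] Xᵐᵒᵖ) ({r | CalcRel 𝕜 X r} ∪ S)))

instance : Module 𝕜 (Forms 𝕜 S) :=
  Module.compHom _ (algebraMap 𝕜 (X ⊗[𝕜] Xᵐᵒᵖ))

instance : Module X (Forms 𝕜 S) :=
  Module.compHom _
    (Algebra.TensorProduct.includeLeft : X →ₐ[𝕜] X ⊗[𝕜] Xᵐᵒᵖ).toRingHom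

instance : Module Xᵐᵒᵖ (Forms 𝕜 S) :=
  Module.compHom _
    (Algebra.TensorProduct.includeRight : Xᵐᵒᵖ →ₐ[𝕜] X ⊗[𝕜] Xᵐᵒᵖ).toRingHom

variable {S}

theorem smul_left_def (a : X) (m : Forms 𝕜 S) :
    a • m = (a ⊗ₜ[𝕜] (1 : Xᵐᵒᵖ)) • m := rfl

theorem smul_right_def (b : X) (m : Forms 𝕜 S) :
    m <• b = ((1 : X) ⊗ₜ[𝕜] MulOpposite.op b) • m := rfl

theorem smul_base_def (c : 𝕜) (m : Forms 𝕜 S) :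
    c • m = algebraMap 𝕜 (X ⊗[𝕜] Xᵐᵒᵖ) c • m := rfl

instance : IsScalarTower 𝕜 X (Forms 𝕜 S) where
  smul_assoc c a m := by
    rw [smul_left_def, smul_left_def, smul_base_def, smul_smul, ← Algebra.smul_def,
      TensorProduct.smul_tmul']

instance : IsScalarTower 𝕜 Xᵐᵒᵖ (Forms 𝕜 S) where
  smul_assoc c a m := by
    change ((1 : X) ⊗ₜ[𝕜] (c • a)) • m = algebraMap 𝕜 (X ⊗[𝕜] Xᵐᵒᵖ) c • ((1 : X) ⊗ₜ[𝕜] a) • m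
    rw [smul_smul, ← Algebra.smul_def, TensorProduct.tmul_smul]

instance : SMulCommClass X Xᵐᵒᵖ (Forms 𝕜 S) where
  smul_comm a b m := by
    change (a ⊗ₜ[𝕜] (1 : Xᵐᵒᵖ)) • ((1 : X) ⊗ₜ[𝕜] b) • m
      = ((1 : X) ⊗ₜ[𝕜] b) • (a ⊗ₜ[𝕜] (1 : Xᵐᵒᵖ)) • m
    simp [smul_smul]

/-- The class of an element of the free bimodule. -/
def mk (S : Set (PreForms 𝕜 X)) : PreForms 𝕜 X →ₗ[X ⊗[𝕜] Xᵐᵒᵖ] Forms 𝕜 S :=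
  Submodule.mkQ (Submodule.span (X ⊗[𝕜] Xᵐᵒᵖ) ({r | CalcRel 𝕜 X r} ∪ S))

theorem mk_smul_base (c : 𝕜) (m : PreForms 𝕜 X) : mk 𝕜 S (c • m) = c • mk 𝕜 S m := by
  rw [smul_base_def, ← map_smul, algebraMap_smul]

theorem mk_pre (a c b : X) : mk 𝕜 S (pre 𝕜 a c b) = a • (mk 𝕜 S (pre 𝕜 1 c 1) <• b) := by
  rw [smul_left_def, smul_right_def, ← map_smul, ← map_smul, smul_pre, ← MulOpposite.op_one,
    smul_pre, one_mul, mul_one, one_mul, mul_one]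

theorem mk_calcRel {r : PreForms 𝕜 X} (h : CalcRel 𝕜 X r) : mk 𝕜 S r = 0 :=
  (Submodule.Quotient.mk_eq_zero _).2 (Submodule.subset_span (Or.inl h))

theorem mk_rel {r : PreForms 𝕜 X} (h : r ∈ S) : mk 𝕜 S r = 0 :=
  (Submodule.Quotient.mk_eq_zero _).2 (Submodule.subset_span (Or.inr h))

/-- The differential `a ↦ d a`. -/
def d (S : Set (PreForms 𝕜 X)) : X →ₗ[𝕜] Forms 𝕜 S where
  toFun a := mk 𝕜 S (pre 𝕜 1 a 1)
  map_add' a b := by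
    have h := mk_calcRel 𝕜 (S := S) (CalcRel.add a b)
    rw [map_sub, map_sub, sub_sub, sub_eq_zero] at h
    exact h
  map_smul' c a := by
    have h := mk_calcRel 𝕜 (S := S) (CalcRel.smul c a)
    rw [map_sub, sub_eq_zero, mk_smul_base] at h
    exact h

theorem mk_pre' (a c b : X) : mk 𝕜 S (pre 𝕜 a c b) = a • (d 𝕜 S c <• b) := mk_pre 𝕜 a c b

theorem isFODC (S : Set (PreForms 𝕜 X)) : IsFODC (d 𝕜 S) := by
  have hl : ∀ a b : X, d 𝕜 S (a * b) = (d 𝕜 S a) <• b + a • d 𝕜 S b := by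
    intro a b
    have h := mk_calcRel 𝕜 (S := S) (CalcRel.mul a b)
    rw [map_sub, map_sub, sub_sub, sub_eq_zero, mk_pre', mk_pre', mk_pre'] at h
    simpa using h
  refine ⟨hl, ?_⟩
  rw [eq_top_iff]
  rintro m -
  obtain ⟨f, rfl⟩ := Submodule.mkQ_surjective _ m
  change mk 𝕜 S f ∈ _
  induction f using PreForms.induct with
  | h0 => rw [map_zero]; exact Submodule.zero_mem _
  | ha f g hf hg => rw [map_add]; exact Submodule.add_mem _ hf hg
  | hp a c b =>
    have h2 : (d 𝕜 S c) <• b = d 𝕜 S (c * b) - c • d 𝕜 S b := by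
      rw [hl]; abel
    rw [mk_pre', h2]
    refine Submodule.smul_mem _ _ (Submodule.sub_mem _ ?_ (Submodule.smul_mem _ _ ?_)) <;>
      exact Submodule.subset_span ⟨_, rfl⟩

end Forms

end Presented

/-! ### The two calculi on the quantum Euclidean sphere

The sign `ε = 1` gives the calculus `Γ₊`, the sign `ε = -1` gives `Γ₋`. -/

/-- The coefficient `(q^N - q^{N-2}) / (1 ∓ q^{N-1})` of `K`. -/
def coeffK (q : ℝ) (N : ℕ) (ε : ℝ) : ℝ :=
  (q ^ (N : ℝ) - q ^ ((N : ℝ) - 2)) / (1 - ε * q ^ ((N : ℝ) - 1))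

/-- The coefficient `(1 ∓ q)(1 + q^{N-2}) / (1 ∓ q^{N-1})` of the cubic term. -/
def coeffCubic (q : ℝ) (N : ℕ) (ε : ℝ) : ℝ :=
  (1 - ε * q) * (1 + q ^ ((N : ℝ) - 2)) / (1 - ε * q ^ ((N : ℝ) - 1))

section Calculi

variable {𝕜 : Type*} [RCLike 𝕜] {q : ℝ} {N : ℕ} {Γ : Type*} [AddCommGroup Γ] [Module 𝕜 Γ]
  [Module (Sphere 𝕜 q N) Γ] [Module (Sphere 𝕜 q N)ᵐᵒᵖ Γ]

/-- The left-module form of the bimodule structure: `d x_i · x_j` equals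
`± R̂⁻¹^{kl}_{ij} x_k d x_l + (± q - 1) x_i d x_j + coeffK K^{kl}_{ij} x_k d x_l
+ coeffCubic C^{kl} x_i x_j x_k d x_l`. -/
def LeftForm (ε : ℝ) (d : Sphere 𝕜 q N →ₗ[𝕜] Γ) : Prop :=
  ∀ i j : Fin N,
    d (x 𝕜 q i) <• x 𝕜 q j =
      (ε : 𝕜) • (∑ k, ∑ l, ((Rinv q k l i j : ℝ) : 𝕜) • (x 𝕜 q k • d (x 𝕜 q l)))
      + ((ε * q - 1 : ℝ) : 𝕜) • (x 𝕜 q i • d (x 𝕜 q j))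
      + ((coeffK q N ε : ℝ) : 𝕜) •
          (∑ k, ∑ l, ((K q k l i j : ℝ) : 𝕜) • (x 𝕜 q k • d (x 𝕜 q l)))
      + ((coeffCubic q N ε : ℝ) : 𝕜) •
          (∑ k, ∑ l, ((C q k l : ℝ) : 𝕜) •
            ((x 𝕜 q i * x 𝕜 q j * x 𝕜 q k) • d (x 𝕜 q l)))

/-- The right-module form of the bimodule structure: `x_i d x_j` equals
`± R̂⁻¹^{kl}_{ij} d x_k · x_l + (± q - 1) d x_i · x_j + coeffK K^{kl}_{ij} d x_k · x_l
+ coeffCubic C^{kl} d x_k · x_l x_i x_j`. -/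
def RightForm (ε : ℝ) (d : Sphere 𝕜 q N →ₗ[𝕜] Γ) : Prop :=
  ∀ i j : Fin N,
    x 𝕜 q i • d (x 𝕜 q j) =
      (ε : 𝕜) • (∑ k, ∑ l, ((Rinv q k l i j : ℝ) : 𝕜) • (d (x 𝕜 q k) <• x 𝕜 q l))
      + ((ε * q - 1 : ℝ) : 𝕜) • (d (x 𝕜 q i) <• x 𝕜 q j)
      + ((coeffK q N ε : ℝ) : 𝕜) •
          (∑ k, ∑ l, ((K q k l i j : ℝ) : 𝕜) • (d (x 𝕜 q k) <• x 𝕜 q l))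
      + ((coeffCubic q N ε : ℝ) : 𝕜) •
          (∑ k, ∑ l, ((C q k l : ℝ) : 𝕜) •
            (d (x 𝕜 q k) <• (x 𝕜 q l * x 𝕜 q i * x 𝕜 q j)))

end Calculi

/-- The defining bimodule relations of `Γ₊` and `Γ₋`, as elements of the free bimodule. -/
def gammaRel (𝕜 : Type*) [RCLike 𝕜] (q : ℝ) (N : ℕ) (ε : ℝ) :
    Set (PreForms 𝕜 (Sphere 𝕜 q N)) :=
  {r | ∃ i j : Fin N, r = pre 𝕜 1 (x 𝕜 q i) (x 𝕜 q j) -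
      ((ε : 𝕜) • (∑ k, ∑ l, ((Rinv q k l i j : ℝ) : 𝕜) • pre 𝕜 (x 𝕜 q k) (x 𝕜 q l) 1)
      + ((ε * q - 1 : ℝ) : 𝕜) • pre 𝕜 (x 𝕜 q i) (x 𝕜 q j) 1
      + ((coeffK q N ε : ℝ) : 𝕜) •
          (∑ k, ∑ l, ((K q k l i j : ℝ) : 𝕜) • pre 𝕜 (x 𝕜 q k) (x 𝕜 q l) 1)
      + ((coeffCubic q N ε : ℝ) : 𝕜) •
          (∑ k, ∑ l, ((C q k l : ℝ) : 𝕜) •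
            pre 𝕜 (x 𝕜 q i * x 𝕜 q j * x 𝕜 q k) (x 𝕜 q l) 1))}

/-- The bimodules of one-forms `Γ₊` (`ε = 1`) and `Γ₋` (`ε = -1`). -/
abbrev Gamma (𝕜 : Type*) [RCLike 𝕜] (q : ℝ) (N : ℕ) (ε : ℝ) : Type _ :=
  Forms 𝕜 (gammaRel 𝕜 q N ε)

/-- The differentials of `Γ₊` and `Γ₋`. -/
def dGamma (𝕜 : Type*) [RCLike 𝕜] (q : ℝ) (N : ℕ) (ε : ℝ) :
    Sphere 𝕜 q N →ₗ[𝕜] Gamma 𝕜 q N ε :=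
  Forms.d 𝕜 (gammaRel 𝕜 q N ε)

theorem isFODC_dGamma (𝕜 : Type*) [RCLike 𝕜] (q : ℝ) (N : ℕ) (ε : ℝ) :
    IsFODC (dGamma 𝕜 q N ε) :=
  Forms.isFODC 𝕜 _

theorem leftForm_dGamma (𝕜 : Type*) [RCLike 𝕜] (q : ℝ) (N : ℕ) (ε : ℝ) :
    LeftForm ε (dGamma 𝕜 q N ε) := by
  intro i j
  have h := Forms.mk_rel 𝕜 (S := gammaRel 𝕜 q N ε) ⟨i, j, rfl⟩
  rw [map_sub, sub_eq_zero] at h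
  simp only [map_add, map_sum, Forms.mk_smul_base, Forms.mk_pre', MulOpposite.op_one,
    one_smul] at h
  exact h

end QSphere

end

/-! Write $\Omega=C_{kl}x_k\,\mathrm dx_l$. The key is that either relation forces $x_j\Omega=\Omega
x_j+\lambda\,\mathrm dx_j$ with the same scalar $\lambda$.

To see this from (1), multiply it on the left by $x$ and contract with $C$. Crossing symmetry
(`rpow_mul_Rinv_eq`) turns $\hat R^{-1}$ acting on a coordinate and a form into $\hat R$ acting on
two coordinates, where the algebra relations evaluate it; the coefficient of $x_j\Omega$ sums to $1$
(`coeff_sum_eq_one`). Relation (2) is handled by the mirror contraction (`smul_rightContr`).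

Differentiating the sphere relation gives $C_{kl}\,\mathrm dx_k\,x_l=-\Omega$, and differentiating
the quadratic relations expresses $\hat R^{-1}$ on $\mathrm dx\,x$ through $\hat R^{-1}$ on
$x\,\mathrm dx$. Commuting $\Omega$ past $x_ix_j$ and using the scalar identity `coeffCubic_mul`,
one finds that (2) becomes (1) up to an overall sign (`IsFODC.left_iff_right`). -/

set_option linter.unusedSectionVars false

noncomputable section

namespace QSphere

/-! ### Contracting the bimodule relations with the metric -/

section Contraction

variable {ι 𝕜 X Γ : Type*} [Fintype ι] [Field 𝕜] [Ring X] [Algebra 𝕜 X]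
  [AddCommGroup Γ] [Module 𝕜 Γ] [Module X Γ] [Module Xᵐᵒᵖ Γ]

/-- The contraction `C_{kl} x_k ω_l` of coordinates with a family of forms. -/
def leftContr (c : ι → ι → 𝕜) (x : ι → X) (ω : ι → Γ) : Γ :=
  ∑ k, ∑ l, c k l • (x k • ω l)

/-- The contraction `C_{kl} ω_k x_l` of a family of forms with coordinates. -/
def rightContr (c : ι → ι → 𝕜) (x : ι → X) (ω : ι → Γ) : Γ :=
  ∑ k, ∑ l, c k l • (ω k <• x l)

theorem smul_base_comm_left [IsScalarTower 𝕜 X Γ] (c : 𝕜) (a : X) (m : Γ) :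
    a • c • m = c • a • m :=
  have : SMulCommClass 𝕜 X Γ := IsScalarTower.to_smulCommClass
  (smul_comm c a m).symm

theorem smul_base_comm_right [IsScalarTower 𝕜 Xᵐᵒᵖ Γ] (c : 𝕜) (a : X) (m : Γ) :
    (c • m) <• a = c • (m <• a) :=
  have : SMulCommClass 𝕜 Xᵐᵒᵖ Γ := IsScalarTower.to_smulCommClass
  (smul_comm c (MulOpposite.op a) m).symm

theorem smul_leftContr [IsScalarTower 𝕜 X Γ] (c : ι → ι → 𝕜) (x : ι → X) (ω : ι → Γ) (a : X) :
    ∑ k, ∑ l, c k l • ((a * x k) • ω l) = a • leftContr c x ω := by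
  simp only [leftContr, Finset.smul_sum, smul_base_comm_left, mul_smul]

theorem rightContr_smul [IsScalarTower 𝕜 Xᵐᵒᵖ Γ] (c : ι → ι → 𝕜) (x : ι → X) (ω : ι → Γ)
    (a : X) :
    ∑ k, ∑ l, c k l • (ω k <• (x l * a)) = rightContr c x ω <• a := by
  simp only [rightContr, Finset.smul_sum, smul_base_comm_right, MulOpposite.op_mul, mul_smul]

variable [DecidableEq ι] {c : ι → ι → 𝕜} {R Ri : ι → ι → ι → ι → 𝕜} {x : ι → X} {ω : ι → Γ}
  {e a s t p r : 𝕜}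

/-- The crossing hypothesis `hcR` trades `Ri` on a coordinate and a form for `R` on two coordinates,
which `hxx` evaluates; `hcc` then collapses the constant term to a multiple of `ω j`. -/
theorem sum_contr_smul_eq
    (hcc : ∀ k j, ∑ l, c k l * c l j = if k = j then 1 else 0)
    (hcR : ∀ k m n j, ∑ l, c k l * Ri m n l j = ∑ l, c l n * R k m j l)
    (hxx : ∀ i j, ∑ k, ∑ l, R k l i j • (x k * x l) = p • (x i * x j) + (r * c i j) • 1)
    [IsScalarTower 𝕜 X Γ] (j : ι) :
    ∑ k, ∑ l, c k l • (x k • ∑ m, ∑ n, Ri m n l j • (x m • ω n))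
      = p • x j • leftContr c x ω + r • ω j := by
  have h1 : ∑ k, ∑ l, c k l • (x k • ∑ m, ∑ n, Ri m n l j • (x m • ω n))
      = ∑ k, ∑ m, ∑ n, (∑ l, c k l * Ri m n l j) • ((x k * x m) • ω n) := by
    refine Finset.sum_congr rfl fun k _ => ?_
    simp only [Finset.smul_sum, Finset.sum_smul, smul_base_comm_left, smul_smul]
    rw [Finset.sum_comm]
    exact Finset.sum_congr rfl fun m _ => Finset.sum_comm
  have h2 : ∑ k, ∑ m, ∑ n, (∑ l, c k l * Ri m n l j) • ((x k * x m) • ω n)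
      = ∑ l, ∑ n, c l n • ((∑ k, ∑ m, R k m j l • (x k * x m)) • ω n) := by
    simp only [hcR, Finset.sum_smul, Finset.smul_sum, smul_assoc, mul_smul]
    calc _ = ∑ k, ∑ m, ∑ l, ∑ n, c l n • R k m j l • x k • x m • ω n :=
          Finset.sum_congr rfl fun k _ => Finset.sum_congr rfl fun m _ => Finset.sum_comm
      _ = ∑ k, ∑ l, ∑ m, ∑ n, c l n • R k m j l • x k • x m • ω n :=
          Finset.sum_congr rfl fun k _ => Finset.sum_comm
      _ = ∑ l, ∑ k, ∑ m, ∑ n, c l n • R k m j l • x k • x m • ω n := Finset.sum_comm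
      _ = ∑ l, ∑ k, ∑ n, ∑ m, c l n • R k m j l • x k • x m • ω n :=
          Finset.sum_congr rfl fun l _ => Finset.sum_congr rfl fun k _ => Finset.sum_comm
      _ = _ := Finset.sum_congr rfl fun l _ => Finset.sum_comm
  have h3 : ∀ l n, c l n • ((p • (x j * x l) + (r * c j l) • (1 : X)) • ω n)
      = p • x j • c l n • x l • ω n + r • ((c j l * c l n) • ω n) := by
    intro l n
    simp only [add_smul, smul_add, smul_assoc, mul_smul, one_smul, smul_base_comm_left]
    rw [smul_comm (c l n) p, smul_comm (c l n) r, smul_comm (c l n) (c j l)]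
  have h4 : ∑ l, ∑ n, r • ((c j l * c l n) • ω n) = r • ω j := by
    rw [Finset.sum_comm]
    simp only [← Finset.smul_sum, ← Finset.sum_smul, hcc, ite_smul, one_smul, zero_smul,
      Finset.sum_ite_eq, Finset.mem_univ, if_true]
  rw [h1, h2]
  simp only [hxx, h3, Finset.sum_add_distrib, h4]
  simp only [leftContr, Finset.smul_sum]

/-- Mirror image of `sum_contr_smul_eq`, with the crossing relation in its reflected form. -/
theorem sum_contr_smul_right_eq
    (hcc : ∀ k j, ∑ l, c k l * c l j = if k = j then 1 else 0)
    (hcR : ∀ l m n j, ∑ k, c k l * Ri m n j k = ∑ k, c m k * R n l k j)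
    (hxx : ∀ i j, ∑ k, ∑ l, R k l i j • (x k * x l) = p • (x i * x j) + (r * c i j) • 1)
    [IsScalarTower 𝕜 Xᵐᵒᵖ Γ] (j : ι) :
    ∑ k, ∑ l, c k l • ((∑ m, ∑ n, Ri m n j k • (ω m <• x n)) <• x l)
      = p • (rightContr c x ω <• x j) + r • ω j := by
  have h1 : ∑ k, ∑ l, c k l • ((∑ m, ∑ n, Ri m n j k • (ω m <• x n)) <• x l)
      = ∑ l, ∑ m, ∑ n, (∑ k, c k l * Ri m n j k) • (ω m <• (x n * x l)) := by
    rw [Finset.sum_comm]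
    refine Finset.sum_congr rfl fun l _ => ?_
    simp only [Finset.smul_sum, Finset.sum_smul, smul_base_comm_right, smul_smul,
      MulOpposite.op_mul]
    rw [Finset.sum_comm]
    exact Finset.sum_congr rfl fun m _ => Finset.sum_comm
  have h2 : ∑ l, ∑ m, ∑ n, (∑ k, c k l * Ri m n j k) • (ω m <• (x n * x l))
      = ∑ m, ∑ k, c m k • (ω m <• (∑ n, ∑ l, R n l k j • (x n * x l))) := by
    simp only [hcR, Finset.sum_smul, Finset.smul_sum, Finset.op_sum, MulOpposite.op_smul,
      smul_assoc, mul_smul]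
    calc _ = ∑ m, ∑ l, ∑ n, ∑ k, c m k • R n l k j • (ω m <• (x n * x l)) := Finset.sum_comm
      _ = ∑ m, ∑ l, ∑ k, ∑ n, c m k • R n l k j • (ω m <• (x n * x l)) :=
          Finset.sum_congr rfl fun m _ => Finset.sum_congr rfl fun l _ => Finset.sum_comm
      _ = ∑ m, ∑ k, ∑ l, ∑ n, c m k • R n l k j • (ω m <• (x n * x l)) :=
          Finset.sum_congr rfl fun m _ => Finset.sum_comm
      _ = _ := Finset.sum_congr rfl fun m _ => Finset.sum_congr rfl fun k _ => Finset.sum_comm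
  have h3 : ∀ m k, c m k • (ω m <• (p • (x k * x j) + (r * c k j) • (1 : X)))
      = p • ((c m k • (ω m <• x k)) <• x j) + r • ((c m k * c k j) • ω m) := by
    intro m k
    simp only [MulOpposite.op_add, MulOpposite.op_smul, MulOpposite.op_mul, MulOpposite.op_one,
      add_smul, smul_add, smul_assoc, mul_smul, one_smul, smul_base_comm_right]
    rw [smul_comm (c m k) p, smul_comm (c m k) r]
  have hcc' : ∀ m, ∑ k, c m k * c k j = if j = m then 1 else 0 := fun m => by
    rw [hcc]; simp only [eq_comm]
  have h4 : ∑ m, ∑ k, r • ((c m k * c k j) • ω m) = r • ω j := by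
    simp only [← Finset.smul_sum, ← Finset.sum_smul, hcc', ite_smul, one_smul, zero_smul,
      Finset.sum_ite_eq, Finset.mem_univ, if_true]
  rw [h1, h2]
  simp only [hxx, h3, Finset.sum_add_distrib, h4]
  simp only [rightContr, Finset.smul_sum]

/-- Contracting `hL` from the left, the `e` term is evaluated by crossing, the `a` and `t` terms by
the sphere relation, and the `s` term because `c` squares to the identity. When `e * p + s + t = 1`
this makes `ω j` proportional to a commutator with the contraction. -/
theorem leftContr_smul_right
    (hcc : ∀ k j, ∑ l, c k l * c l j = if k = j then 1 else 0)
    (hcR : ∀ k m n j, ∑ l, c k l * Ri m n l j = ∑ l, c l n * R k m j l)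
    (hxx : ∀ i j, ∑ k, ∑ l, R k l i j • (x k * x l) = p • (x i * x j) + (r * c i j) • 1)
    (hsph : ∑ k, ∑ l, c k l • (x k * x l) = 1)
    [IsScalarTower 𝕜 X Γ] [IsScalarTower 𝕜 Xᵐᵒᵖ Γ] [SMulCommClass X Xᵐᵒᵖ Γ]
    (hL : ∀ i j, ω i <• x j = e • (∑ k, ∑ l, Ri k l i j • (x k • ω l)) + a • (x i • ω j)
      + s • (c i j • leftContr c x ω) + t • ((x i * x j) • leftContr c x ω)) (j : ι) :
    leftContr c x ω <• x j
      = (e * p + s + t) • (x j • leftContr c x ω) + (e * r + a) • ω j := by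
  -- Commuting left and right actions let `x j` act directly on each `ω l`, where `hL` applies.
  have h0 : leftContr c x ω <• x j = ∑ k, ∑ l, c k l • (x k • (ω l <• x j)) := by
    simp only [leftContr, Finset.smul_sum, smul_base_comm_right]
    refine Finset.sum_congr rfl fun k _ => Finset.sum_congr rfl fun l _ => ?_
    rw [smul_comm (x k)]
  have h1 : ∀ k l, c k l • (x k • (ω l <• x j)) =
      e • (c k l • (x k • ∑ m, ∑ n, Ri m n l j • (x m • ω n)))
      + a • ((c k l • (x k * x l)) • ω j)
      + s • ((c k l * c l j) • (x k • leftContr c x ω))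
      + t • ((c k l • (x k * x l)) • (x j • leftContr c x ω)) := by
    intro k l
    rw [hL]
    simp only [smul_add, smul_base_comm_left, smul_assoc, mul_smul]
    rw [smul_comm (c k l) e, smul_comm (c k l) a, smul_comm (c k l) s, smul_comm (c k l) t]
  have h2 : ∑ k, ∑ l, (c k l * c l j) • (x k • leftContr c x ω) = x j • leftContr c x ω := by
    simp only [← Finset.sum_smul, hcc, ite_smul, one_smul, zero_smul, Finset.sum_ite_eq',
      Finset.mem_univ, if_true]
  rw [h0]
  simp only [h1, Finset.sum_add_distrib, ← Finset.smul_sum, sum_contr_smul_eq hcc hcR hxx, h2]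
  simp only [← Finset.sum_smul, hsph, one_smul, add_smul, smul_add, mul_smul]
  abel

theorem smul_rightContr
    (hcc : ∀ k j, ∑ l, c k l * c l j = if k = j then 1 else 0)
    (hcR : ∀ l m n j, ∑ k, c k l * Ri m n j k = ∑ k, c m k * R n l k j)
    (hxx : ∀ i j, ∑ k, ∑ l, R k l i j • (x k * x l) = p • (x i * x j) + (r * c i j) • 1)
    (hsph : ∑ k, ∑ l, c k l • (x k * x l) = 1)
    [IsScalarTower 𝕜 X Γ] [IsScalarTower 𝕜 Xᵐᵒᵖ Γ] [SMulCommClass X Xᵐᵒᵖ Γ]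
    (hR : ∀ i j, x i • ω j = e • (∑ k, ∑ l, Ri k l i j • (ω k <• x l)) + a • (ω i <• x j)
      + s • (c i j • rightContr c x ω) + t • (rightContr c x ω <• (x i * x j))) (j : ι) :
    x j • rightContr c x ω
      = (e * p + s + t) • (rightContr c x ω <• x j) + (e * r + a) • ω j := by
  have h0 : x j • rightContr c x ω = ∑ k, ∑ l, c k l • ((x j • ω k) <• x l) := by
    simp only [rightContr, Finset.smul_sum, smul_base_comm_left]
    refine Finset.sum_congr rfl fun k _ => Finset.sum_congr rfl fun l _ => ?_
    rw [smul_comm (x j)]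
  have h1 : ∀ k l, c k l • ((x j • ω k) <• x l) =
      e • (c k l • ((∑ m, ∑ n, Ri m n j k • (ω m <• x n)) <• x l))
      + a • (ω j <• (c k l • (x k * x l)))
      + s • ((c j k * c k l) • (rightContr c x ω <• x l))
      + t • ((rightContr c x ω <• x j) <• (c k l • (x k * x l))) := by
    intro k l
    rw [hR]
    simp only [smul_add, smul_base_comm_right, MulOpposite.op_smul, MulOpposite.op_mul,
      smul_assoc, mul_smul]
    rw [smul_comm (c k l) e, smul_comm (c k l) a, smul_comm (c k l) s, smul_comm (c k l) t,
      smul_comm (c k l) (c j k)]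
  have h2 : ∑ k, ∑ l, (c j k * c k l) • (rightContr c x ω <• x l)
      = rightContr c x ω <• x j := by
    rw [Finset.sum_comm]
    simp only [← Finset.sum_smul, hcc, ite_smul, one_smul, zero_smul, Finset.sum_ite_eq,
      Finset.mem_univ, if_true]
  rw [h0]
  simp only [h1, Finset.sum_add_distrib, ← Finset.smul_sum, sum_contr_smul_right_eq hcc hcR hxx,
    h2, ← Finset.sum_smul, ← Finset.op_sum, hsph, MulOpposite.op_one, one_smul]
  simp only [add_smul, smul_add, mul_smul]
  abel

end Contraction

/-! ### Symmetries of the metric and the R-matrix -/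

theorem rho_rev {N : ℕ} (i : Fin N) : rho i.rev = -rho i := by
  have hi := i.isLt
  have hc : ((i.rev : ℕ) : ℝ) = N - (i + 1) := by
    rw [Fin.val_rev, Nat.cast_sub hi]; push_cast; ring
  have hv : (i.rev : ℕ) = N - (i + 1) := Fin.val_rev i
  unfold rho
  rw [hc]
  split_ifs <;> first | omega | ring

theorem fin_rev_eq_comm {N : ℕ} {i j : Fin N} : i.rev = j ↔ i = j.rev :=
  ⟨fun h => h ▸ (Fin.rev_rev i).symm, fun h => h ▸ Fin.rev_rev j⟩

theorem C_rev_left (q : ℝ) {N : ℕ} (i j : Fin N) :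
    C q i j = if j = i.rev then q ^ (-rho i) else 0 := by
  unfold C
  simp only [← fin_rev_eq_comm (i := i), eq_comm (a := j)]

theorem sum_C_mul_left (q : ℝ) {N : ℕ} (k : Fin N) (f : Fin N → ℝ) :
    ∑ l, C q k l * f l = q ^ (-rho k) * f k.rev := by
  simp [C_rev_left]

theorem sum_C_mul_right (q : ℝ) {N : ℕ} (n : Fin N) (f : Fin N → ℝ) :
    ∑ l, C q l n * f l = q ^ (rho n) * f n.rev := by
  simp [C, rho_rev]

theorem sum_C_mul_C {q : ℝ} (hq : 0 < q) {N : ℕ} (k j : Fin N) :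
    ∑ l, C q k l * C q l j = if k = j then 1 else 0 := by
  rw [sum_C_mul_left, C_rev_left, Fin.rev_rev, rho_rev]
  simp only [eq_comm (a := j)]
  split_ifs
  · rw [← Real.rpow_add hq]; simp
  · simp

/-- Crossing symmetry of the R-matrix. -/
theorem rpow_mul_Rinv_eq {q : ℝ} (hq : 0 < q) {N : ℕ} (k m n j : Fin N) :
    q ^ (rho k) * Rinv q m n k j = q ^ (rho n) * R q k.rev m j n.rev := by
  have hmul : ∀ a : ℝ, q ^ a * q ^ (-a) = 1 := fun a => by
    rw [← Real.rpow_add hq]; simp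
  have h1 := hmul (rho n)
  have h2 := hmul (rho k)
  rcases lt_trichotomy k n with h | h | h
  -- For `k < n` both sides vanish: in `Rinv` the triangular part of `R` cancels against the added
  -- multiples of `I` and `K`, and on the right the condition `j < m` excludes the supports of `I`
  -- and `K`.
  · have h' : ¬ n < k := h.asymm
    have hR : R q k.rev m j n.rev = 0 := by
      unfold R I K C
      by_cases hjm : j < m
      · have ha : ¬ (j = k.rev ∧ n.rev = m) := fun ⟨ha, hb⟩ => h' (by
          rw [ha, ← hb, Fin.rev_lt_rev] at hjm; exact hjm)
        have hb : ¬ (j = n ∧ k = m) := fun ⟨ha, hb⟩ => h' (by rwa [ha, ← hb] at hjm)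
        simp only [Fin.rev_rev, Fin.rev_inj, h.ne', and_false, ha, hjm, if_true, if_false]
        rcases not_and_or.1 hb with hb | hb <;> simp [hb]
      · simp [hjm, h.ne']
    rw [hR]
    unfold Rinv R
    simp only [h, h.ne, false_and, if_false, if_true]
    ring
  · subst h
    congr 1
    unfold Rinv R I K
    by_cases hjm : j = m
    · subst hjm
      simp only [lt_irrefl, if_false, and_true, fin_rev_eq_comm, if_true]
      by_cases ha : k = j <;> by_cases hb : k = j.rev
      · have hb' : j = j.rev := ha.symm.trans hb
        subst ha
        -- Here `k` is the middle index, fixed by reversal.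
        have h3 : rho k = 0 := by
          have := rho_rev k; rw [← hb'] at this; linarith
        simp [C, ← hb', h3]
      · subst ha
        have hb' : k ≠ k.rev := hb
        simp [C, hb', Real.rpow_neg_one]
      · have hb' : j = k.rev := by rw [hb, Fin.rev_rev]
        have hc : k ≠ k.rev := fun h => ha (h.trans hb'.symm)
        subst hb'
        simp only [C, Fin.rev_rev, hc, hc.symm, if_true, if_false, rho_rev, neg_neg, zero_sub,
          sub_zero, false_and, mul_zero, add_zero]
        rw [mul_comm (q ^ (-rho k)), hmul, Real.rpow_neg_one, Real.rpow_one]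
        ring
      · have hb' : j ≠ k.rev := fun h => hb (by rw [h, Fin.rev_rev])
        simp [C, ha, hb, hb', Ne.symm ha]
    · have hI : ¬ (k = m ∧ j = k) := fun ⟨ha, hb⟩ => hjm (hb.trans ha)
      have hI' : ¬ (j = k.rev ∧ k.rev = m) := fun ⟨ha, hb⟩ => hjm (ha.trans hb)
      have hC : C q k j * C q m k = 0 := by
        rw [C_rev_left, C]
        split_ifs with ha hb
        · exact (hjm (ha.trans hb.symm)).elim
        all_goals simp
      have hC' : C q j k.rev * C q k.rev m = 0 := by
        rw [C, C_rev_left, Fin.rev_rev]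
        split_ifs with ha hb
        · exact (hjm (ha.trans hb.symm)).elim
        all_goals simp
      simp [hjm, hI, hI', hC, hC']
  -- For `n < k` only multiples of `I` and `K` survive; crossing interchanges their supports, and
  -- the powers of `q` absorb the weights of `K`.
  · have h' : ¬ k < n := h.asymm
    have hK : K q m n k j
        = if j = k.rev ∧ n.rev = m then q ^ (-rho k) * q ^ rho n else 0 := by
      rw [K, C_rev_left, C, ite_zero_mul_ite_zero]
      simp only [eq_comm (a := n.rev)]
      split_ifs with ha
      · rw [ha.2, rho_rev, neg_neg]
      · rfl
    have hK' : K q k.rev m j n.rev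
        = if k = m ∧ j = n then q ^ (-rho n) * q ^ rho k else 0 := by
      rw [K, C, C_rev_left, ite_zero_mul_ite_zero, Fin.rev_rev, Fin.rev_rev, rho_rev, neg_neg]
      simp only [eq_comm (a := m), and_comm (a := k = m)]
      split_ifs with ha
      · rw [ha.1]
      · rfl
    -- The triangularity condition is automatic on the supports of `I` and `K` because `n < k`.
    have hlt : (if j < m then I k.rev m j n.rev - K q k.rev m j n.rev else 0)
        = I k.rev m j n.rev - K q k.rev m j n.rev := by
      refine ite_eq_left_iff.2 fun hjm => ?_
      have hI : ¬ (k = m ∧ j = n) := fun ⟨ha, hb⟩ => hjm (by rwa [← ha, hb])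
      have hI' : ¬ (j = k.rev ∧ n.rev = m) := fun ⟨ha, hb⟩ => hjm (by
        rwa [ha, ← hb, Fin.rev_lt_rev])
      rw [hK', I, if_neg hI, if_neg hI', sub_zero]
    unfold Rinv R
    rw [hlt, hK, hK', I, I]
    simp only [Fin.rev_inj, h', h.ne, h.ne', and_false, false_and, if_false]
    split_ifs
    · linear_combination (q - q⁻¹) * q ^ rho k * h1 + (q - q⁻¹) * q ^ rho n * h2
    · linear_combination (q - q⁻¹) * q ^ rho k * h1
    · linear_combination (q - q⁻¹) * q ^ rho n * h2
    · ring

theorem C_rev_rev (q : ℝ) {N : ℕ} (i j : Fin N) : C q j.rev i.rev = C q i j := by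
  rw [C_rev_left, Fin.rev_rev, C]
  simp only [fin_rev_eq_comm]
  split_ifs with h
  · rw [h]
  · rfl

theorem K_rev_rev (q : ℝ) {N : ℕ} (k l i j : Fin N) :
    K q l.rev k.rev j.rev i.rev = K q k l i j := by
  rw [K, K, C_rev_rev, C_rev_rev]

theorem I_rev_rev {N : ℕ} (k l i j : Fin N) : I l.rev k.rev j.rev i.rev = I k l i j := by
  simp only [I, Fin.rev_inj, and_comm]

/-- The only asymmetric ingredient is the condition `i < l`, which becomes `k < j`. The two agree
wherever `I` or `K` is nonzero. -/
theorem R_rev_rev (q : ℝ) {N : ℕ} (k l i j : Fin N) :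
    R q l.rev k.rev j.rev i.rev = R q k l i j := by
  unfold R
  rw [K_rev_rev, I_rev_rev]
  simp only [Fin.rev_inj, Fin.rev_rev, Fin.rev_lt_rev]
  congr 1
  · simp only [and_comm, eq_comm (a := l), eq_comm (a := l.rev)]
  · congr 1
    by_cases h : i = k ∧ j = l
    · rw [← h.1, ← h.2]
    · by_cases h' : i = j.rev ∧ k = l.rev
      · simp only [h'.1, h'.2, Fin.rev_lt_iff]
      · have hK : K q k l i j = 0 := by
          rw [K, C, C, ite_zero_mul_ite_zero, if_neg h']
        simp [I, h, hK]

theorem Rinv_rev_rev (q : ℝ) {N : ℕ} (k l i j : Fin N) :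
    Rinv q l.rev k.rev j.rev i.rev = Rinv q k l i j := by
  rw [Rinv, R_rev_rev, K_rev_rev, I_rev_rev, Rinv]

theorem sum_C_mul_Rinv_left {q : ℝ} (hq : 0 < q) {N : ℕ} (k m n j : Fin N) :
    ∑ l, C q k l * Rinv q m n l j = ∑ l, C q l n * R q k m j l := by
  rw [sum_C_mul_left q k fun l => Rinv q m n l j, sum_C_mul_right q n fun l => R q k m j l,
    ← rho_rev, rpow_mul_Rinv_eq hq, Fin.rev_rev]

/-- Reversing all indices reduces this to the same crossing identity as the left version. -/
theorem sum_C_mul_Rinv_right {q : ℝ} (hq : 0 < q) {N : ℕ} (l m n j : Fin N) :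
    ∑ k, C q k l * Rinv q m n j k = ∑ k, C q m k * R q n l k j := by
  rw [sum_C_mul_right q l fun k => Rinv q m n j k, sum_C_mul_left q m fun k => R q n l k j,
    ← rho_rev, ← Rinv_rev_rev, ← R_rev_rev, Fin.rev_rev, Fin.rev_rev, rpow_mul_Rinv_eq hq,
    Fin.rev_rev]

/-! ### Equivalence of the two forms for an abstract calculus -/

section Inner

variable {ι 𝕜 X Γ : Type*} [Fintype ι] [Field 𝕜] [Ring X] [Algebra 𝕜 X]
  [AddCommGroup Γ] [Module 𝕜 Γ] [Module X Γ] [Module Xᵐᵒᵖ Γ] [IsScalarTower 𝕜 X Γ]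
  [IsScalarTower 𝕜 Xᵐᵒᵖ Γ] [SMulCommClass X Xᵐᵒᵖ Γ] {d : X →ₗ[𝕜] Γ} {x : ι → X}
  {c : ι → ι → 𝕜} {Ri : ι → ι → ι → ι → 𝕜} {e a s t u r lam : 𝕜}

theorem IsFODC.map_one (hd : IsFODC d) : d 1 = 0 := by
  simpa using hd.leibniz 1 1

/-- Apply `d` to the sphere relation and use `d 1 = 0`. -/
theorem IsFODC.rightContr_eq_neg (hd : IsFODC d)
    (hsph : ∑ k, ∑ l, c k l • (x k * x l) = 1) :
    rightContr c x (fun i => d (x i)) = -leftContr c x (fun i => d (x i)) := by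
  have h := congrArg d hsph
  simp only [map_sum, map_smul, hd.leibniz, hd.map_one, smul_add, Finset.sum_add_distrib] at h
  exact eq_neg_of_add_eq_zero_left h

/-- Apply `d` to the quadratic relation; the constant term is killed. -/
theorem IsFODC.sum_smul_right_eq (hd : IsFODC d)
    (hxx : ∀ i j, ∑ k, ∑ l, Ri k l i j • (x k * x l) = u • (x i * x j) + (r * c i j) • 1)
    (i j : ι) :
    ∑ k, ∑ l, Ri k l i j • (d (x k) <• x l)
      = u • (d (x i) <• x j) + u • (x i • d (x j))
        - ∑ k, ∑ l, Ri k l i j • (x k • d (x l)) := by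
  have h := congrArg d (hxx i j)
  simp only [map_add, map_sum, map_smul, hd.leibniz, hd.map_one, smul_add,
    Finset.sum_add_distrib, smul_zero, add_zero] at h
  exact eq_sub_of_add_eq h

/-- In a calculus where the differentials of the coordinates are commutators with an invariant
form, the left and the right forms of the bimodule relations agree. -/
theorem IsFODC.left_iff_right (hd : IsFODC d)
    (hxx : ∀ i j, ∑ k, ∑ l, Ri k l i j • (x k * x l) = u • (x i * x j) + (r * c i j) • 1)
    (hsph : ∑ k, ∑ l, c k l • (x k * x l) = 1)
    (hlam : t * lam = 1 - a - e * u)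
    (hcomm : ∀ j, x j • leftContr c x (fun i => d (x i))
      = leftContr c x (fun i => d (x i)) <• x j + lam • d (x j)) (i j : ι) :
    d (x i) <• x j
        = e • (∑ k, ∑ l, Ri k l i j • (x k • d (x l))) + a • (x i • d (x j))
          + s • (c i j • leftContr c x (fun i => d (x i)))
          + t • ((x i * x j) • leftContr c x (fun i => d (x i))) ↔
      x i • d (x j)
        = e • (∑ k, ∑ l, Ri k l i j • (d (x k) <• x l)) + a • (d (x i) <• x j)
          + s • (c i j • rightContr c x (fun i => d (x i)))
          + t • (rightContr c x (fun i => d (x i)) <• (x i * x j)) := by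
  rw [hd.sum_smul_right_eq hxx, hd.rightContr_eq_neg hsph]
  set Ω := leftContr c x (fun i => d (x i))
  -- The commutator with `Ω` is a derivation, so on `x i * x j` it gives `lam` times the Leibniz
  -- expansion of the differential.
  have h : (x i * x j) • Ω
      = Ω <• (x i * x j) + lam • (d (x i) <• x j) + lam • (x i • d (x j)) := by
    rw [mul_smul, hcomm, smul_add, smul_base_comm_left, smul_comm, hcomm, smul_add,
      smul_base_comm_right, MulOpposite.op_mul, mul_smul]
  have h' : t • (Ω <• (x i * x j)) = t • ((x i * x j) • Ω)
      - (1 - a - e * u) • (d (x i) <• x j) - (1 - a - e * u) • (x i • d (x j)) := by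
    rw [h, ← hlam]
    simp only [smul_add, mul_smul]
    abel
  simp only [smul_neg, h']
  generalize (x i * x j) • Ω = A
  generalize ∑ k, ∑ l, Ri k l i j • (x k • d (x l)) = B
  generalize d (x i) <• x j = v
  generalize x i • d (x j) = w
  simp only [smul_sub, smul_add, sub_smul, one_smul, mul_smul]
  -- After the substitutions, left side minus right side in one relation is the negative of that in
  -- the other.
  rw [← sub_eq_zero, ← sub_eq_zero (a := w), ← neg_eq_zero]
  refine Eq.congr ?_ rfl
  abel

end Inner

/-! ### Specialisation to the quantum sphere -/

section Calculi

variable {𝕜 : Type*} [RCLike 𝕜] {q : ℝ} {N : ℕ}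

theorem sum_C_smul_x_mul_x :
    ∑ k : Fin N, ∑ l, ((C q k l : ℝ) : 𝕜) • (x 𝕜 q k * x 𝕜 q l) = 1 := by
  have h := RingQuot.mkAlgHom_rel 𝕜 (SphereRel.sphere (𝕜 := 𝕜) (q := q) (N := N))
  simp only [map_sum, map_smul, map_mul, map_one] at h
  exact h

theorem sum_K_smul {M : Type*} [AddCommGroup M] [Module 𝕜 M] (i j : Fin N)
    (f : Fin N → Fin N → M) :
    ∑ k, ∑ l, ((K q k l i j : ℝ) : 𝕜) • f k l
      = ((C q i j : ℝ) : 𝕜) • ∑ k, ∑ l, ((C q k l : ℝ) : 𝕜) • f k l := by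
  simp only [K, RCLike.ofReal_mul, mul_smul, Finset.smul_sum]

theorem sum_Rinv_smul_x_mul_x (i j : Fin N) :
    ∑ k, ∑ l, ((Rinv q k l i j : ℝ) : 𝕜) • (x 𝕜 q k * x 𝕜 q l)
      = ((q⁻¹ : ℝ) : 𝕜) • (x 𝕜 q i * x 𝕜 q j)
        + ((((q ^ ((N : ℝ) - 1) - q ^ ((N : ℝ) - 3)) / (1 + q ^ ((N : ℝ) - 2)) : ℝ) : 𝕜)
          * ((C q i j : ℝ) : 𝕜)) • 1 := by
  have h := RingQuot.mkAlgHom_rel 𝕜 (SphereRel.quadratic (𝕜 := 𝕜) (q := q) i j)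
  simp only [map_add, map_sum, map_smul, map_mul] at h
  rw [mul_smul, ← sum_C_smul_x_mul_x (q := q),
    ← sum_K_smul i j fun k l => x 𝕜 q k * x 𝕜 q l]
  exact h

theorem sum_I_smul {M : Type*} [AddCommGroup M] [Module 𝕜 M] (i j : Fin N)
    (f : Fin N → Fin N → M) :
    ∑ k, ∑ l, ((I k l i j : ℝ) : 𝕜) • f k l = f i j := by
  simp only [I, ite_and]
  simp [apply_ite (fun r : ℝ => (r : 𝕜))]

/-- Since $\hat R=\hat R^{-1}+(q-q^{-1})(I-K)$, the coefficient $q^{-1}$ becomes $q$ and the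
constant drops by $q-q^{-1}$. -/
theorem sum_R_smul {M : Type*} [AddCommGroup M] [Module 𝕜 M] {i j : Fin N}
    {f : Fin N → Fin N → M} {o : M} {r : ℝ}
    (hRinv : ∑ k, ∑ l, ((Rinv q k l i j : ℝ) : 𝕜) • f k l
      = ((q⁻¹ : ℝ) : 𝕜) • f i j + ((r : 𝕜) * ((C q i j : ℝ) : 𝕜)) • o)
    (hC : ∑ k, ∑ l, ((C q k l : ℝ) : 𝕜) • f k l = o) :
    ∑ k, ∑ l, ((R q k l i j : ℝ) : 𝕜) • f k l
      = (q : 𝕜) • f i j + (((r - (q - q⁻¹) : ℝ) : 𝕜) * ((C q i j : ℝ) : 𝕜)) • o := by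
  have h : ∀ k l, R q k l i j
      = Rinv q k l i j + (q - q⁻¹) * I k l i j - (q - q⁻¹) * K q k l i j := fun k l => by
    rw [Rinv]; ring
  simp only [h, RCLike.ofReal_sub, RCLike.ofReal_add, RCLike.ofReal_mul, sub_smul, add_smul,
    mul_smul, Finset.sum_sub_distrib, Finset.sum_add_distrib, ← Finset.smul_sum, hRinv,
    sum_I_smul, sum_K_smul, hC]
  abel

theorem sum_R_smul_x_mul_x (i j : Fin N) :
    ∑ k, ∑ l, ((R q k l i j : ℝ) : 𝕜) • (x 𝕜 q k * x 𝕜 q l)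
      = ((q : ℝ) : 𝕜) • (x 𝕜 q i * x 𝕜 q j)
        + ((((q ^ ((N : ℝ) - 1) - q ^ ((N : ℝ) - 3)) / (1 + q ^ ((N : ℝ) - 2)) - (q - q⁻¹) : ℝ)
            : 𝕜) * ((C q i j : ℝ) : 𝕜)) • 1 :=
  sum_R_smul (f := fun k l => x 𝕜 q k * x 𝕜 q l) (sum_Rinv_smul_x_mul_x i j) sum_C_smul_x_mul_x

theorem one_sub_mul_rpow_ne_zero (hq0 : 0 < q) (hq1 : q ≠ 1) (hN : 2 ≤ N) {ε : ℝ}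
    (hε : ε = 1 ∨ ε = -1) : 1 - ε * q ^ ((N : ℝ) - 1) ≠ 0 := by
  have hN' : (2 : ℝ) ≤ N := by exact_mod_cast hN
  have hpos := Real.rpow_pos_of_pos hq0 ((N : ℝ) - 1)
  rcases hε with rfl | rfl
  · intro h
    rcases lt_or_gt_of_ne hq1 with h1 | h1
    · have := Real.rpow_lt_one hq0.le h1 (z := (N : ℝ) - 1) (by linarith)
      linarith
    · have := Real.one_lt_rpow h1 (z := (N : ℝ) - 1) (by linarith)
      linarith
  · linarith

theorem rpow_natCast_sub (hq0 : 0 < q) :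
    q ^ ((N : ℝ) - 1) = q * q ^ ((N : ℝ) - 2) ∧ q ^ ((N : ℝ) - 3) = q⁻¹ * q ^ ((N : ℝ) - 2) ∧
      q ^ (N : ℝ) = q ^ 2 * q ^ ((N : ℝ) - 2) := by
  refine ⟨?_, ?_, ?_⟩
  · rw [mul_comm, ← Real.rpow_add_one hq0.ne']; ring_nf
  · rw [← Real.rpow_neg_one, ← Real.rpow_add hq0]; ring_nf
  · rw [← Real.rpow_natCast, ← Real.rpow_add hq0]; push_cast; ring_nf

/-- This is `e * p + s + t = 1` for the contracted relation: the coefficients are tuned so that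
$\Omega$ commutes with $x_j$ up to a multiple of $\mathrm dx_j$. -/
theorem coeff_sum_eq_one (hq0 : 0 < q) (hq1 : q ≠ 1) (hN : 2 ≤ N) {ε : ℝ}
    (hε : ε = 1 ∨ ε = -1) : ε * q + coeffK q N ε + coeffCubic q N ε = 1 := by
  have h := one_sub_mul_rpow_ne_zero hq0 hq1 hN hε
  have hε2 : ε ^ 2 = 1 := by rcases hε with rfl | rfl <;> norm_num
  obtain ⟨h1, h2, h3⟩ := rpow_natCast_sub (N := N) hq0
  unfold coeffK coeffCubic
  rw [h1, ← mul_assoc] at h ⊢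
  rw [h3]
  field_simp
  linear_combination (-q ^ 2 * q ^ ((N : ℝ) - 2)) * hε2

/-- The second factor is $\lambda=-\varepsilon q^{-1}(1-\varepsilon q)(1-\varepsilon
q^{N-1})/(1+q^{N-2})$, so both sides equal $-\varepsilon q^{-1}(1-\varepsilon q)^2$. -/
theorem coeffCubic_mul (hq0 : 0 < q) (hq1 : q ≠ 1) (hN : 2 ≤ N) {ε : ℝ}
    (hε : ε = 1 ∨ ε = -1) :
    coeffCubic q N ε * -(ε * ((q ^ ((N : ℝ) - 1) - q ^ ((N : ℝ) - 3)) / (1 + q ^ ((N : ℝ) - 2))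
      - (q - q⁻¹)) + (ε * q - 1)) = 1 - (ε * q - 1) - ε * q⁻¹ := by
  have h := one_sub_mul_rpow_ne_zero hq0 hq1 hN hε
  obtain ⟨h1, h2, h3⟩ := rpow_natCast_sub (N := N) hq0
  have hpos := Real.rpow_pos_of_pos hq0 ((N : ℝ) - 2)
  have h' : 1 + q ^ ((N : ℝ) - 2) ≠ 0 := by positivity
  unfold coeffCubic
  rw [h1] at h ⊢
  rw [h2]
  generalize q ^ ((N : ℝ) - 2) = T at *
  rcases hε with rfl | rfl
  · replace h : 1 - q * T ≠ 0 := by simpa using h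
    rw [one_mul (q * T)]
    field_simp
    ring
  · replace h : 1 + q * T ≠ 0 := by simpa using h
    rw [neg_one_mul (q * T), sub_neg_eq_add]
    field_simp
    ring

variable {Γ : Type*} [AddCommGroup Γ] [Module 𝕜 Γ]
  [Module (Sphere 𝕜 q N) Γ] [Module (Sphere 𝕜 q N)ᵐᵒᵖ Γ]
  [IsScalarTower 𝕜 (Sphere 𝕜 q N) Γ] [IsScalarTower 𝕜 (Sphere 𝕜 q N)ᵐᵒᵖ Γ]
  [SMulCommClass (Sphere 𝕜 q N) (Sphere 𝕜 q N)ᵐᵒᵖ Γ] {d : Sphere 𝕜 q N →ₗ[𝕜] Γ} {ε : ℝ}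

theorem leftForm_iff :
    LeftForm ε d ↔ ∀ i j, d (x 𝕜 q i) <• x 𝕜 q j
      = (ε : 𝕜) • (∑ k, ∑ l, ((Rinv q k l i j : ℝ) : 𝕜) • (x 𝕜 q k • d (x 𝕜 q l)))
        + ((ε * q - 1 : ℝ) : 𝕜) • (x 𝕜 q i • d (x 𝕜 q j))
        + ((coeffK q N ε : ℝ) : 𝕜) • (((C q i j : ℝ) : 𝕜) •
          leftContr (fun k l => ((C q k l : ℝ) : 𝕜)) (x 𝕜 q) (fun i => d (x 𝕜 q i)))
        + ((coeffCubic q N ε : ℝ) : 𝕜) • ((x 𝕜 q i * x 𝕜 q j) •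
          leftContr (fun k l => ((C q k l : ℝ) : 𝕜)) (x 𝕜 q) (fun i => d (x 𝕜 q i))) := by
  refine forall_congr' fun i => forall_congr' fun j => ?_
  rw [sum_K_smul, smul_leftContr (fun k l => ((C q k l : ℝ) : 𝕜)) (x 𝕜 q)
    (fun i => d (x 𝕜 q i))]
  rfl

theorem rightForm_iff :
    RightForm ε d ↔ ∀ i j, x 𝕜 q i • d (x 𝕜 q j)
      = (ε : 𝕜) • (∑ k, ∑ l, ((Rinv q k l i j : ℝ) : 𝕜) • (d (x 𝕜 q k) <• x 𝕜 q l))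
        + ((ε * q - 1 : ℝ) : 𝕜) • (d (x 𝕜 q i) <• x 𝕜 q j)
        + ((coeffK q N ε : ℝ) : 𝕜) • (((C q i j : ℝ) : 𝕜) •
          rightContr (fun k l => ((C q k l : ℝ) : 𝕜)) (x 𝕜 q) (fun i => d (x 𝕜 q i)))
        + ((coeffCubic q N ε : ℝ) : 𝕜) •
          (rightContr (fun k l => ((C q k l : ℝ) : 𝕜)) (x 𝕜 q) (fun i => d (x 𝕜 q i))
            <• (x 𝕜 q i * x 𝕜 q j)) := by
  refine forall_congr' fun i => forall_congr' fun j => ?_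
  simp only [mul_assoc (x 𝕜 q _) (x 𝕜 q i)]
  rw [sum_K_smul, rightContr_smul (fun k l => ((C q k l : ℝ) : 𝕜)) (x 𝕜 q)
    (fun i => d (x 𝕜 q i))]
  rfl

theorem leftForm_iff_rightForm (hq0 : 0 < q) (hq1 : q ≠ 1) (hN : 2 ≤ N)
    (hε : ε = 1 ∨ ε = -1) (hd : IsFODC d) : LeftForm ε d ↔ RightForm ε d := by
  have hsum : (ε : 𝕜) * (q : 𝕜) + (coeffK q N ε : 𝕜) + (coeffCubic q N ε : 𝕜) = 1 := by
    exact_mod_cast congrArg (RCLike.ofReal (K := 𝕜)) (coeff_sum_eq_one hq0 hq1 hN hε)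
  have hlam := congrArg (RCLike.ofReal (K := 𝕜)) (coeffCubic_mul hq0 hq1 hN hε)
  have hcc : ∀ k j : Fin N, ∑ l, ((C q k l : ℝ) : 𝕜) * ((C q l j : ℝ) : 𝕜)
      = if k = j then 1 else 0 := fun k j => by
    have h := congrArg (RCLike.ofReal (K := 𝕜)) (sum_C_mul_C hq0 k j)
    split_ifs at h ⊢ <;> simpa using h
  have hl : ∀ k m n j : Fin N, ∑ l, ((C q k l : ℝ) : 𝕜) * ((Rinv q m n l j : ℝ) : 𝕜)
      = ∑ l, ((C q l n : ℝ) : 𝕜) * ((R q k m j l : ℝ) : 𝕜) := fun k m n j => by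
    exact_mod_cast congrArg (RCLike.ofReal (K := 𝕜)) (sum_C_mul_Rinv_left hq0 k m n j)
  have hr : ∀ l m n j : Fin N, ∑ k, ((C q k l : ℝ) : 𝕜) * ((Rinv q m n j k : ℝ) : 𝕜)
      = ∑ k, ((C q m k : ℝ) : 𝕜) * ((R q n l k j : ℝ) : 𝕜) := fun l m n j => by
    exact_mod_cast congrArg (RCLike.ofReal (K := 𝕜)) (sum_C_mul_Rinv_right hq0 l m n j)
  have hiff := hd.left_iff_right (s := (coeffK q N ε : 𝕜)) (e := (ε : 𝕜))
    (a := ((ε * q - 1 : ℝ) : 𝕜)) sum_Rinv_smul_x_mul_x sum_C_smul_x_mul_x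
    (by simpa only [RCLike.ofReal_mul, RCLike.ofReal_sub, RCLike.ofReal_one] using hlam)
  rw [leftForm_iff, rightForm_iff]
  constructor
  · intro h i j
    -- The commutator hypothesis of `hiff` has to be derived from whichever form is assumed.
    refine (hiff (fun j => ?_) i j).1 (h i j)
    rw [leftContr_smul_right hcc hl sum_R_smul_x_mul_x sum_C_smul_x_mul_x h j, hsum]
    simp only [RCLike.ofReal_neg, RCLike.ofReal_add, RCLike.ofReal_mul, neg_smul, one_smul]
    abel
  · intro h i j
    refine (hiff (fun j => ?_) i j).2 (h i j)
    -- Because the right contraction is $-\Omega$, the mirror identity yields the commutator with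
    -- the same $\lambda$ as in the other direction.
    have h' := smul_rightContr hcc hr sum_R_smul_x_mul_x sum_C_smul_x_mul_x h j
    rw [hsum, hd.rightContr_eq_neg sum_C_smul_x_mul_x, smul_neg, smul_neg, neg_eq_iff_eq_neg,
      one_smul] at h'
    rw [h']
    simp only [RCLike.ofReal_neg, RCLike.ofReal_add, RCLike.ofReal_mul, neg_smul]
    abel

end Calculi

end QSphere

end

theorem mainTheorem10 {𝕜 : Type*} [RCLike 𝕜] (q : ℝ) (hq0 : 0 < q) (hq1 : q ≠ 1)
    (N : ℕ) (hN : 3 ≤ N) (ε : ℝ) (hε : ε = 1 ∨ ε = -1) :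
    QSphere.RightForm ε (QSphere.dGamma 𝕜 q N ε) ∧
    ∀ (Γ : Type*) [AddCommGroup Γ] [Module 𝕜 Γ]
      [Module (QSphere.Sphere 𝕜 q N) Γ] [Module (QSphere.Sphere 𝕜 q N)ᵐᵒᵖ Γ]
      [IsScalarTower 𝕜 (QSphere.Sphere 𝕜 q N) Γ]
      [IsScalarTower 𝕜 (QSphere.Sphere 𝕜 q N)ᵐᵒᵖ Γ]
      [SMulCommClass (QSphere.Sphere 𝕜 q N) (QSphere.Sphere 𝕜 q N)ᵐᵒᵖ Γ]
      (d : QSphere.Sphere 𝕜 q N →ₗ[𝕜] Γ), QSphere.IsFODC d →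
      (QSphere.LeftForm ε d ↔ QSphere.RightForm ε d) := by
  exact ⟨(QSphere.leftForm_iff_rightForm hq0 hq1 (by lia) hε (QSphere.isFODC_dGamma 𝕜 q N ε)).1
      (QSphere.leftForm_dGamma 𝕜 q N ε),
    fun _ _ _ _ _ _ _ _ _ hd => QSphere.leftForm_iff_rightForm hq0 hq1 (by lia) hε hd⟩
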